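/- Let $N\ge 1$ and let $H=(h_{k,j})\in\mathbb{R}^{(N-1)\times(N-1)}$ be lower triangular. For an operator $T$ on a Euclidean space and a starting point $y_0$, the algorithm represented by $H$ generates \[ y_{k+1}=y_k-\sum_{j=0}^{k}h_{k+1,j+1}\,(y_j-Ty_j),\qquad k=0,\dots,N-2 . \] For $1\le m\le k\le N-1$ put \[ P(k,m;H)=\sum_{1\le j(1)\le i(1)<j(2)\le i(2)<\cdots<j(m)\le i(m)\le k}\ \prod_{r=1}^{m}h_{i(r),j(r)} , \] and assume the H-invariance conditions $P(N-1,m;H)=\frac1N\binom{N}{m+1}$ for $m=1,\dots,N-1$. For vectors $y_0,g_1,\dots,g_N$ of a Euclidean space $\mathbb{R}^d$ define formally $y_{k}=y_{k-1}-\sum_{j=1}^{k}2h_{k,j}g_j$ ($k=1,\dots,N-1$) and $x_k=y_{k-1}-g_k$ ($k=1,\dots,N$). The H-certificates of $H$ are the real numbers $\lambda^\star_{k,j}(H)$, $1\le j<k\le N$, for which \[ 0=N\|g_N\|^2+\langle g_N,x_N-y_0\rangle+\sum_{k=1}^{N}\sum_{j=1}^{k-1}\lambda^\star_{k,j}(H)\,\langle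 x_k-x_j,\,g_k-g_j\rangle \] holds identically, that is, for all $d$ and all $y_0,g_1,\dots,g_N\in\mathbb{R}^d$. Theorem. Under the H-invariance conditions the H-certificates are well defined: there is exactly one such family of numbers. Moreover, if $\lambda^\star_{i_0,j_0}(H)<0$ for some $1\le j_0<i_0\le N$, then there exist a nonexpansive (1-Lipschitz) operator $T\colon\mathbb{R}^{N+1}\to\mathbb{R}^{N+1}$, a starting point $y_0$ and a fixed point $y_\star=Ty_\star$ such that $\|y_0-y_\star\|=1$ and the iterate $y_{N-1}$ of the algorithm represented by $H$ satisfies \[ \|y_{N-1}-Ty_{N-1}\|^2>\frac{4}{N^2}. \] -/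

import Mathlib

noncomputable section

namespace HMatrix

/-- The entry `h_{i,j}` of a lower triangular matrix, with indices counted from `1`
(and `0` outside the range `1 ≤ j ≤ i ≤ n`). -/
def entry {n : ℕ} (H : Matrix (Fin n) (Fin n) ℝ) (i j : ℕ) : ℝ :=
  if hij : 1 ≤ j ∧ j ≤ i ∧ i ≤ n then H ⟨i - 1, by omega⟩ ⟨j - 1, by omega⟩ else 0

/-- The index sequences `1 ≤ j(1) ≤ i(1) < j(2) ≤ i(2) < ⋯ < j(m) ≤ i(m) ≤ k`;
the `r`-th member of a sequence `p` is the pair `p r = (i(r), j(r))`. -/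
def chains (k m : ℕ) : Finset (Fin m → ℕ × ℕ) :=
  (Fintype.piFinset fun _ : Fin m => Finset.Icc 1 k ×ˢ Finset.Icc 1 k).filter fun p =>
    (∀ r, (p r).2 ≤ (p r).1) ∧
      ∀ r s : Fin m, (r : ℕ) + 1 = (s : ℕ) → (p r).1 < (p s).2

/-- The polynomial `P(k, m; H)` in the entries of `H`. -/
def P {n : ℕ} (H : Matrix (Fin n) (Fin n) ℝ) (k m : ℕ) : ℝ :=
  ∑ p ∈ chains k m, ∏ r, entry H (p r).1 (p r).2

/-- The H-invariance conditions
`P(N-1, m; H) = (1/N) * (N choose (m+1))` for `m = 1, …, N-1`. -/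
def HInvariance (N : ℕ) (H : Matrix (Fin (N - 1)) (Fin (N - 1)) ℝ) : Prop :=
  ∀ m : ℕ, 1 ≤ m → m ≤ N - 1 → P H (N - 1) m = 1 / (N : ℝ) * (N.choose (m + 1) : ℝ)

section Vectors

variable {E : Type*} [AddCommGroup E] [Module ℝ E]

/-- The iterates `y_0, y_1, …` of the algorithm with matrix `H` applied to `T` from `y0`:
`y_{k+1} = y_k - ∑_{j=0}^{k} h_{k+1,j+1} (y_j - T y_j)`. -/
def iterate {n : ℕ} (H : Matrix (Fin n) (Fin n) ℝ) (T : E → E) (y0 : E) : ℕ → E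
  | 0 => y0
  | k + 1 => iterate H T y0 k -
      ∑ j : Fin (k + 1), entry H (k + 1) (j + 1) •
        (iterate H T y0 j - T (iterate H T y0 j))

/-- The points `y_k` written formally in terms of `y0` and the vectors `g_1, g_2, …`:
`y_{k+1} = y_k - ∑_{j=0}^{k} 2 h_{k+1,j+1} g_{j+1}`. -/
def formalY {n : ℕ} (H : Matrix (Fin n) (Fin n) ℝ) (y0 : E) (g : ℕ → E) : ℕ → E
  | 0 => y0
  | k + 1 => formalY H y0 g k -
      ∑ j ∈ Finset.range (k + 1), (2 * entry H (k + 1) (j + 1)) • g (j + 1)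

/-- The points `x_k = y_{k-1} - g_k`, for `k ≥ 1`. -/
def formalX {n : ℕ} (H : Matrix (Fin n) (Fin n) ℝ) (y0 : E) (g : ℕ → E) (k : ℕ) : E :=
  formalY H y0 g (k - 1) - g k

end Vectors

/-- `lam` is a family `(lam_{k,j})_{1 ≤ j < k ≤ N}` (extended by `0` to all other indices)
for which `0 = N ‖g_N‖² + ⟪g_N, x_N - y_0⟫ + ∑_{k=1}^{N} ∑_{j=1}^{k-1} lam_{k,j}
⟪x_k - x_j, g_k - g_j⟫` is an identity in the free vectors `y_0, g_1, …, g_N`. -/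
structure IsCertificate (N : ℕ) (H : Matrix (Fin (N - 1)) (Fin (N - 1)) ℝ)
    (lam : ℕ → ℕ → ℝ) : Prop where
  support : ∀ k j : ℕ, ¬ (1 ≤ j ∧ j < k ∧ k ≤ N) → lam k j = 0
  identity : ∀ (d : ℕ) (y0 : EuclideanSpace ℝ (Fin d)) (g : ℕ → EuclideanSpace ℝ (Fin d)),
    0 = (N : ℝ) * ‖g N‖ ^ 2 + inner ℝ (g N) (formalX H y0 g N - y0) +
      ∑ k ∈ Finset.Icc 1 N, ∑ j ∈ Finset.Ico 1 k,
        lam k j * inner ℝ (formalX H y0 g k - formalX H y0 g j) (g k - g j)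

open Classical in
/-- The H-certificates `λ⋆_{k,j}(H)`: the unique family with `IsCertificate`
(and, conventionally, `0` if there is no such unique family). -/
def certificate (N : ℕ) (H : Matrix (Fin (N - 1)) (Fin (N - 1)) ℝ) : ℕ → ℕ → ℝ :=
  if h : ∃! lam, IsCertificate N H lam then h.choose else 0

end HMatrix

end

/-! Encode a run by its points `x_k` and vectors `g_k`, with `x_k + g_k = y_{k-1}` and `x_k - g_k =
T y_{k-1}`: `T` is nonexpansive on the iterates iff all pairings `⟪x_k - x_j, g_k - g_j⟫` are
nonnegative, and isometric there iff they vanish. The universal isometric model is multiplication by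
`X` on `ℝ[X]` from `1`; there the invariance conditions say `N y_{N-1} = 1 + X + ⋯ + X^(N-1)`, i.e.
`N g_N = (1 - X^N) / 2` (`polyY_eq_sum`, `natCast_smul_polyG`).

Existence is linear duality: a Gram array killing all pairings comes from a shift-invariant form on
`ℝ[X]`, and such a form kills `N ‖g_N‖² + ⟪g_N, x_N - y_0⟫` (`gram_objective_eq_zero`).

For the rest, let `X` act as a negacyclic shift, so that `N g_N = y_0`. Perturbing this instance
gives the pairings arbitrary first-order changes (`exists_perturbation`), which forces uniqueness.
If some certificate is negative, make its pairing grow at rate about `1` and all others at a tiny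
positive rate: the certificate identity then pushes `N² ‖g_N‖²` above `1`, and Kirszbraun's theorem
extends the data to a nonexpansive operator. -/

namespace HMatrix

open Polynomial

/-! ### Kirszbraun's extension theorem. -/

section Kirszbraun

variable {E : Type*} [NormedAddCommGroup E] [InnerProductSpace ℝ E]

/-- The variance identity for weights of total mass one. -/
theorem sum_sum_mul_norm_sub_sq {ι : Type*} [Fintype ι] (c : ι → ℝ) (hc : ∑ i, c i = 1)
    (q : ι → E) :
    ∑ i, ∑ j, c i * c j * ‖q i - q j‖ ^ 2 =
      2 * ∑ i, c i * ‖q i‖ ^ 2 - 2 * ‖∑ i, c i • q i‖ ^ 2 := by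
  have h1 : ‖∑ i, c i • q i‖ ^ 2 = ∑ i, ∑ j, c i * c j * inner ℝ (q i) (q j) := by
    rw [← real_inner_self_eq_norm_sq, sum_inner]
    refine Finset.sum_congr rfl fun i _ => ?_
    rw [inner_sum]
    refine Finset.sum_congr rfl fun j _ => ?_
    rw [real_inner_smul_left, real_inner_smul_right]; ring
  have h2 : ∑ i, ∑ j, c i * c j * ‖q i‖ ^ 2 = ∑ i, c i * ‖q i‖ ^ 2 := by
    refine Finset.sum_congr rfl fun i _ => ?_
    rw [← Finset.sum_mul, ← Finset.mul_sum, hc, mul_one]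
  have h3 : ∑ i, ∑ j, c i * c j * ‖q j‖ ^ 2 = ∑ i, c i * ‖q i‖ ^ 2 := by
    rw [Finset.sum_comm, ← h2]
    refine Finset.sum_congr rfl fun i _ => Finset.sum_congr rfl fun j _ => by ring
  have h4 : ∑ i, ∑ j, c i * c j * ‖q i - q j‖ ^ 2 =
      ∑ i, ∑ j, c i * c j * ‖q i‖ ^ 2 - 2 * ∑ i, ∑ j, c i * c j * inner ℝ (q i) (q j) +
        ∑ i, ∑ j, c i * c j * ‖q j‖ ^ 2 := by
    simp only [Finset.mul_sum, ← Finset.sum_sub_distrib, ← Finset.sum_add_distrib]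
    refine Finset.sum_congr rfl fun i _ => Finset.sum_congr rfl fun j _ => ?_
    rw [norm_sub_sq_real]; ring
  rw [h4, h2, h3, h1]; ring

/-- One-point extension of a `1`-Lipschitz correspondence between finitely many points. -/
theorem exists_norm_sub_le_of_finite {ι : Type*} [Fintype ι] (a q : ι → E)
    (h : ∀ i j, ‖q i - q j‖ ≤ ‖a i - a j‖) : ∃ z : E, ∀ i, ‖z - q i‖ ≤ ‖a i‖ := by
  classical
  cases isEmpty_or_nonempty ι with
  | inl hι => exact ⟨0, fun i => hι.elim i⟩
  | inr hι =>
  obtain ⟨i₀⟩ := hι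
  -- `φ` is the Lagrange dual of minimising over `z` the largest `‖z - q i‖² - ‖a i‖²`; the
  -- barycentre at a maximiser `c` is the point sought.
  let φ : (ι → ℝ) → ℝ := fun c =>
    ∑ i, c i * (‖q i‖ ^ 2 - ‖a i‖ ^ 2) - ‖∑ i, c i • q i‖ ^ 2
  have hφ : Continuous φ := by fun_prop
  obtain ⟨c, hcmem, hmax⟩ := (isCompact_stdSimplex ℝ ι).exists_isMaxOn
    ⟨Pi.single i₀ 1, single_mem_stdSimplex ℝ i₀⟩ hφ.continuousOn
  set z := ∑ i, c i • q i with hz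
  have hc1 : ∑ i, c i = 1 := hcmem.2
  have hφc : φ c ≤ 0 := by
    have hq := sum_sum_mul_norm_sub_sq c hc1 q
    have ha := sum_sum_mul_norm_sub_sq c hc1 a
    have hle : ∑ i, ∑ j, c i * c j * ‖q i - q j‖ ^ 2 ≤
        ∑ i, ∑ j, c i * c j * ‖a i - a j‖ ^ 2 := by
      refine Finset.sum_le_sum fun i _ => Finset.sum_le_sum fun j _ => ?_
      have := mul_nonneg (hcmem.1 i) (hcmem.1 j)
      have := h i j
      gcongr
    have : φ c = ∑ i, c i * ‖q i‖ ^ 2 - ∑ i, c i * ‖a i‖ ^ 2 - ‖z‖ ^ 2 := by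
      simp only [φ, mul_sub, Finset.sum_sub_distrib, hz]
    have := sq_nonneg ‖∑ i, c i • a i‖
    linarith
  refine ⟨z, fun i => ?_⟩
  -- Optimality of `c` against a move towards the vertex `i`, divided by `t`; letting `t → 0` bounds
  -- `‖z - q i‖² - ‖a i‖²` by `φ c ≤ 0`.
  have key : ∀ t : ℝ, 0 < t → t ≤ 1 →
      ‖z - q i‖ ^ 2 - ‖a i‖ ^ 2 - φ c ≤ t * ‖z - q i‖ ^ 2 := by
    intro t ht ht1
    have hmem : (fun j => (1 - t) * c j + t * (Pi.single i 1 : ι → ℝ) j) ∈ stdSimplex ℝ ι := by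
      have := convex_stdSimplex ℝ ι hcmem (single_mem_stdSimplex ℝ i)
        (sub_nonneg.2 ht1) ht.le (by ring)
      exact this
    have hle : φ _ ≤ φ c := hmax hmem
    have e1 : ∑ j, ((1 - t) * c j + t * (Pi.single i 1 : ι → ℝ) j) * (‖q j‖ ^ 2 - ‖a j‖ ^ 2) =
        (1 - t) * ∑ j, c j * (‖q j‖ ^ 2 - ‖a j‖ ^ 2) + t * (‖q i‖ ^ 2 - ‖a i‖ ^ 2) := by
      simp only [add_mul, Finset.sum_add_distrib, mul_assoc, ← Finset.mul_sum]
      simp [Pi.single_apply]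
    have e2 : ∑ j, ((1 - t) * c j + t * (Pi.single i 1 : ι → ℝ) j) • q j = z - t • (z - q i) := by
      simp only [add_smul, Finset.sum_add_distrib, mul_smul, ← Finset.smul_sum]
      rw [← hz]
      simp [Pi.single_apply]
      module
    have e3 : ∑ j, c j * (‖q j‖ ^ 2 - ‖a j‖ ^ 2) = φ c + ‖z‖ ^ 2 := by
      simp only [φ, ← hz]; ring
    have e4 : ‖z - t • (z - q i)‖ ^ 2 =
        ‖z‖ ^ 2 - 2 * t * inner ℝ z (z - q i) + t ^ 2 * ‖z - q i‖ ^ 2 := by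
      rw [norm_sub_sq_real, real_inner_smul_right, norm_smul, mul_pow, Real.norm_eq_abs, sq_abs]
      ring
    have e5 : ‖q i‖ ^ 2 = ‖z‖ ^ 2 - 2 * inner ℝ z (z - q i) + ‖z - q i‖ ^ 2 := by
      rw [← norm_sub_sq_real]; congr 2; abel
    have e6 : φ (fun j => (1 - t) * c j + t * (Pi.single i 1 : ι → ℝ) j) =
        (1 - t) * (φ c + ‖z‖ ^ 2) + t * (‖q i‖ ^ 2 - ‖a i‖ ^ 2) - ‖z - t • (z - q i)‖ ^ 2 := by
      rw [← e3, ← e1, ← e2]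
    rw [e6, e4, e5] at hle
    have : t * (‖z - q i‖ ^ 2 - ‖a i‖ ^ 2 - φ c) ≤ t * (t * ‖z - q i‖ ^ 2) := by nlinarith
    exact le_of_mul_le_mul_left this ht
  have hlim : ‖z - q i‖ ^ 2 - ‖a i‖ ^ 2 - φ c ≤ 0 := by
    by_contra hcon
    push Not at hcon
    set A := ‖z - q i‖ ^ 2 - ‖a i‖ ^ 2 - φ c
    have hB : 0 ≤ ‖z - q i‖ ^ 2 := sq_nonneg _
    have h2 := key (min 1 (A / (2 * (‖z - q i‖ ^ 2 + 1)))) (by positivity) (min_le_left _ _)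
    have h3 : min 1 (A / (2 * (‖z - q i‖ ^ 2 + 1))) * ‖z - q i‖ ^ 2 ≤
        A / (2 * (‖z - q i‖ ^ 2 + 1)) * (‖z - q i‖ ^ 2 + 1) := by
      gcongr
      · exact min_le_right _ _
      · linarith
    have h4 : A / (2 * (‖z - q i‖ ^ 2 + 1)) * (‖z - q i‖ ^ 2 + 1) = A / 2 := by
      field_simp
    linarith
  exact le_of_sq_le_sq (by linarith) (norm_nonneg _)

/-- Kirszbraun's theorem: a `1`-Lipschitz relation in a finite-dimensional Euclidean space is
contained in the graph of a `1`-Lipschitz map. -/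
theorem exists_lipschitzWith_one_of_relation [FiniteDimensional ℝ E] (G : Set (E × E))
    (hG : ∀ a ∈ G, ∀ b ∈ G, ‖a.2 - b.2‖ ≤ ‖a.1 - b.1‖) :
    ∃ T : E → E, LipschitzWith 1 T ∧ ∀ a ∈ G, T a.1 = a.2 := by
  let S : Set (Set (E × E)) := {M | ∀ a ∈ M, ∀ b ∈ M, ‖a.2 - b.2‖ ≤ ‖a.1 - b.1‖}
  obtain ⟨M, hGM, hM⟩ := zorn_subset_nonempty S (by
    intro C hCS hC hne
    refine ⟨⋃₀ C, ?_, fun s hs => Set.subset_sUnion_of_mem hs⟩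
    rintro a ⟨A, hA, haA⟩ b ⟨B, hB, hbB⟩
    rcases hC.total hA hB with hAB | hBA
    · exact hCS hB a (hAB haA) b hbB
    · exact hCS hA a haA b (hBA hbB)) G hG
  have hMS : ∀ a ∈ M, ∀ b ∈ M, ‖a.2 - b.2‖ ≤ ‖a.1 - b.1‖ := hM.prop
  -- Closed balls are compact, so the finite one-point extension suffices; maximality of `M` then
  -- puts `(p, z)` in `M`.
  have hball : ∀ p : E, ∃ z : E, ∀ a ∈ M, ‖z - a.2‖ ≤ ‖p - a.1‖ := by
    intro p
    rcases M.eq_empty_or_nonempty with h0 | ⟨m, hm⟩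
    · exact ⟨0, by simp [h0]⟩
    have hcomp : ∀ a : E × E, IsCompact (Metric.closedBall a.2 ‖p - a.1‖) := fun a =>
      isCompact_closedBall _ _
    obtain ⟨z, hz⟩ := (hcomp m).inter_iInter_nonempty
      (fun a : M => Metric.closedBall a.1.2 ‖p - a.1.1‖) (fun a => (hcomp a.1).isClosed) (by
        intro u
        classical
        obtain ⟨z, hz⟩ := exists_norm_sub_le_of_finite
          (ι := (insert (⟨m, hm⟩ : M) u : Finset M))
          (fun a => p - a.1.1.1) (fun a => a.1.1.2) (by
            intro i j
            refine (hMS _ i.1.2 _ j.1.2).trans_eq ?_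
            rw [sub_sub_sub_cancel_left, norm_sub_rev])
        refine ⟨z, ?_, ?_⟩
        · simpa [dist_eq_norm] using hz ⟨⟨m, hm⟩, Finset.mem_insert_self _ _⟩
        · simp only [Set.mem_iInter]
          intro a ha
          simpa [dist_eq_norm] using hz ⟨a, Finset.mem_insert_of_mem ha⟩)
    refine ⟨z, fun a ha => ?_⟩
    have := Set.mem_iInter.1 hz.2 ⟨a, ha⟩
    simpa [dist_eq_norm] using this
  choose T hT using hball
  have hmem : ∀ p, (p, T p) ∈ M := by
    intro p
    have : insert (p, T p) M ∈ S := by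
      rintro a (rfl | ha) b (rfl | hb)
      · simp
      · exact hT p b hb
      · rw [norm_sub_rev a.2, norm_sub_rev a.1]; exact hT p a ha
      · exact hMS a ha b hb
    exact hM.le_of_ge this (Set.subset_insert _ _) (Set.mem_insert _ _)
  refine ⟨T, LipschitzWith.of_dist_le_mul fun p q => ?_, fun a ha => ?_⟩
  · simpa [dist_eq_norm] using hMS _ (hmem p) _ (hmem q)
  · have := hT a.1 a (hGM ha)
    rw [sub_self, norm_zero] at this
    exact sub_eq_zero.1 (norm_le_zero_iff.1 this)

end Kirszbraun

/-! ### Recursions for `P(k, m; H)`. -/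

section Chains

/-- As `j(r) ≤ i(r)`, the condition on consecutive pairs propagates to all `r < s`, a form that
splits along `Fin.snoc`. -/
theorem mem_chains {k m : ℕ} {p : Fin m → ℕ × ℕ} :
    p ∈ chains k m ↔ (∀ r, 1 ≤ (p r).2 ∧ (p r).2 ≤ (p r).1 ∧ (p r).1 ≤ k) ∧
      ∀ r s : Fin m, r < s → (p r).1 < (p s).2 := by
  simp only [chains, Finset.mem_filter, Fintype.mem_piFinset, Finset.mem_product, Finset.mem_Icc]
  constructor
  · rintro ⟨h1, h2, h3⟩
    refine ⟨fun r => ⟨(h1 r).2.1, h2 r, (h1 r).1.2⟩, ?_⟩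
    have : ∀ s : ℕ, ∀ hs : s < m, ∀ r : Fin m, (r : ℕ) < s → (p r).1 < (p ⟨s, hs⟩).2 := by
      intro s
      induction s with
      | zero => intro _ r hr; omega
      | succ s ih =>
        intro hs r hr
        have h4 := h3 ⟨s, by omega⟩ ⟨s + 1, hs⟩ rfl
        rcases Nat.lt_succ_iff_lt_or_eq.1 hr with h | h
        · exact (ih (by omega) r h).trans_le ((h2 _).trans h4.le)
        · exact h3 r ⟨s + 1, hs⟩ (by simp [h])
    exact fun r s hrs => this s s.2 r hrs
  · rintro ⟨h1, h2⟩
    refine ⟨fun r => ?_, fun r => (h1 r).2.1, fun r s hrs => h2 r s (by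
      rw [Fin.lt_def]; omega)⟩
    obtain ⟨ha, hb, hc⟩ := h1 r
    omega

theorem snoc_mem_chains {k m : ℕ} {p : Fin m → ℕ × ℕ} {x : ℕ × ℕ} :
    (Fin.snoc p x : Fin (m + 1) → ℕ × ℕ) ∈ chains k (m + 1) ↔
      (1 ≤ x.1 ∧ x.1 ≤ k) ∧ (1 ≤ x.2 ∧ x.2 ≤ x.1) ∧ p ∈ chains (x.2 - 1) m := by
  simp only [mem_chains, Fin.forall_fin_succ', Fin.snoc_castSucc, Fin.snoc_last,
    Fin.castSucc_lt_castSucc_iff, Fin.castSucc_lt_last, lt_irrefl, true_implies,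
    false_implies, and_true]
  constructor
  · rintro ⟨⟨h1, h2⟩, h3, -⟩
    refine ⟨⟨by omega, by omega⟩, ⟨by omega, by omega⟩, fun r => ?_, fun r s => (h3 r).1 s⟩
    have := (h3 r).2
    have := h1 r
    omega
  · rintro ⟨h1, h2, h3, h4⟩
    refine ⟨⟨fun r => ?_, by omega⟩, fun r => ⟨h4 r, ?_⟩, fun r hr => ?_⟩
    · have := h3 r
      omega
    · have := h3 r
      omega
    · exact absurd hr (Fin.le_last _).not_gt

variable {n : ℕ} (H : Matrix (Fin n) (Fin n) ℝ)

theorem P_zero (k : ℕ) : P H k 0 = 1 := by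
  have : chains k 0 = Finset.univ := by
    ext p
    simp only [mem_chains, Finset.mem_univ, iff_true]
    exact ⟨fun r => r.elim0, fun r => r.elim0⟩
  simp [P, this]

theorem P_succ (k m : ℕ) :
    P H k (m + 1) = ∑ i ∈ Finset.Icc 1 k, ∑ j ∈ Finset.Icc 1 i, entry H i j * P H (j - 1) m := by
  simp only [P, Finset.mul_sum, Finset.sum_sigma']
  symm
  refine Finset.sum_bij'
    (fun a _ => (Fin.snoc a.2.2 (a.1, a.2.1) : Fin (m + 1) → ℕ × ℕ))
    (fun q _ => ⟨(q (Fin.last m)).1, (q (Fin.last m)).2, Fin.init q⟩) ?_ ?_ ?_ ?_ ?_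
  · rintro ⟨i, j, p⟩ h
    simp only [Finset.mem_sigma, Finset.mem_Icc] at h
    exact snoc_mem_chains.2 h
  · intro q hq
    rw [← Fin.snoc_init_self q] at hq
    have := snoc_mem_chains.1 hq
    simp only [Finset.mem_sigma, Finset.mem_Icc]
    exact this
  · rintro ⟨i, j, p⟩ h
    simp
  · intro q hq
    simp
  · rintro ⟨i, j, p⟩ h
    simp [Fin.prod_univ_castSucc, mul_comm]

/-- Chains whose last pair has first entry `k + 1` are split off. This is the recursion of the
iterates, read coefficientwise. -/
theorem P_succ_succ (k m : ℕ) :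
    P H (k + 1) (m + 1) = P H k (m + 1) +
      ∑ j ∈ Finset.range (k + 1), entry H (k + 1) (j + 1) * P H j m := by
  rw [P_succ, P_succ, Finset.sum_Icc_succ_top (by omega)]
  congr 1
  rw [Finset.range_eq_Ico]
  exact (Finset.sum_Ico_add' (fun j => entry H (k + 1) j * P H (j - 1) m) 0 (k + 1) 1).symm

end Chains

/-! ### Formal iterates: locality, linearity, naturality. -/

section Iterates

variable {E F : Type*} [AddCommGroup E] [Module ℝ E] [AddCommGroup F] [Module ℝ F]
variable {n : ℕ} (H : Matrix (Fin n) (Fin n) ℝ)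

theorem iterate_succ (T : E → E) (y0 : E) (k : ℕ) :
    iterate H T y0 (k + 1) = iterate H T y0 k - ∑ j ∈ Finset.range (k + 1),
      entry H (k + 1) (j + 1) • (iterate H T y0 j - T (iterate H T y0 j)) := by
  rw [iterate, Finset.sum_range fun j =>
    entry H (k + 1) (j + 1) • (iterate H T y0 j - T (iterate H T y0 j))]

theorem formalY_succ (y0 : E) (g : ℕ → E) (k : ℕ) :
    formalY H y0 g (k + 1) = formalY H y0 g k -
      ∑ j ∈ Finset.range (k + 1), (2 * entry H (k + 1) (j + 1)) • g (j + 1) := rfl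

/-- If `y_k - T y_k = 2 g_{k+1}` along the formal iterates, these are the iterates of `T`. -/
theorem iterate_eq_formalY (T : E → E) (y0 : E) (g : ℕ → E) (K : ℕ)
    (h : ∀ k < K, T (formalY H y0 g k) = formalY H y0 g k - (2 : ℝ) • g (k + 1)) :
    ∀ k ≤ K, iterate H T y0 k = formalY H y0 g k := by
  intro k
  induction k using Nat.strong_induction_on with
  | _ k ih =>
  intro hk
  cases k with
  | zero => rw [iterate, formalY]
  | succ k =>
    rw [iterate_succ, formalY_succ, ih k (by omega) (by omega)]
    congr 1
    refine Finset.sum_congr rfl fun j hj => ?_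
    have hj' : j < k + 1 := Finset.mem_range.1 hj
    rw [ih j (by omega) (by omega), h j (by omega)]
    module

theorem formalY_congr (y0 : E) {g g' : ℕ → E} (k : ℕ) (h : ∀ l, 1 ≤ l → l ≤ k → g l = g' l) :
    formalY H y0 g k = formalY H y0 g' k := by
  induction k with
  | zero => rfl
  | succ k ih =>
    rw [formalY_succ, formalY_succ, ih fun l hl hl' => h l hl (by omega)]
    congr 1
    refine Finset.sum_congr rfl fun j hj => ?_
    rw [h (j + 1) (by omega) (by have := Finset.mem_range.1 hj; omega)]

theorem formalX_congr (y0 : E) {g g' : ℕ → E} (k : ℕ) (hk : 1 ≤ k)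
    (h : ∀ l, 1 ≤ l → l ≤ k → g l = g' l) : formalX H y0 g k = formalX H y0 g' k := by
  rw [formalX, formalX, h k hk le_rfl, formalY_congr H y0 _ fun l hl hl' => h l hl (by omega)]

/-- Transfers computations from `ℝ[X]` to Euclidean space, and from vectors to their inner products.
-/
theorem formalY_map (φ : E →ₗ[ℝ] F) (y0 : E) (g : ℕ → E) (k : ℕ) :
    formalY H (φ y0) (fun l => φ (g l)) k = φ (formalY H y0 g k) := by
  induction k with
  | zero => rfl
  | succ k ih => simp only [formalY_succ, ih, map_sub, map_sum, map_smul]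

theorem formalX_map (φ : E →ₗ[ℝ] F) (y0 : E) (g : ℕ → E) (k : ℕ) :
    formalX H (φ y0) (fun l => φ (g l)) k = φ (formalX H y0 g k) := by
  simp only [formalX, formalY_map, map_sub]

theorem formalY_add_smul (y0 : E) (g d : ℕ → E) (ε : ℝ) (k : ℕ) :
    formalY H y0 (fun l => g l + ε • d l) k = formalY H y0 g k + ε • formalY H 0 d k := by
  induction k with
  | zero => simp [formalY]
  | succ k ih =>
    simp only [formalY_succ, ih, smul_add, Finset.sum_add_distrib, smul_sub, Finset.smul_sum,
      smul_comm ε]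
    abel

theorem formalX_add_smul (y0 : E) (g d : ℕ → E) (ε : ℝ) (k : ℕ) :
    formalX H y0 (fun l => g l + ε • d l) k = formalX H y0 g k + ε • formalX H 0 d k := by
  simp only [formalX, formalY_add_smul, smul_sub]
  abel

end Iterates

/-! ### The polynomial model, where `T` is multiplication by `X`. -/

section Model

variable {n : ℕ} (H : Matrix (Fin n) (Fin n) ℝ)

/-- The iterates of the algorithm for multiplication by `X` on `ℝ[X]`, started at `1`. -/
noncomputable def polyY (k : ℕ) : ℝ[X] := iterate H (fun q : ℝ[X] => X * q) 1 k

/-- The vectors `g_k` belonging to `polyY`. -/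
noncomputable def polyG (k : ℕ) : ℝ[X] := (1 / 2 : ℝ) • (polyY H (k - 1) - X * polyY H (k - 1))

theorem polyY_zero : polyY H 0 = 1 := by rw [polyY, iterate]

theorem polyY_succ (k : ℕ) : polyY H (k + 1) = polyY H k -
    ∑ j ∈ Finset.range (k + 1), entry H (k + 1) (j + 1) • (polyY H j - X * polyY H j) :=
  iterate_succ H _ _ k

theorem formalY_polyG (k : ℕ) : formalY H 1 (polyG H) k = polyY H k := by
  induction k with
  | zero => rw [polyY_zero, formalY]
  | succ k ih =>
    rw [polyY_succ, formalY_succ, ih]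
    congr 1
    refine Finset.sum_congr rfl fun j _ => ?_
    rw [polyG, Nat.add_sub_cancel]
    module

theorem formalX_polyG (k : ℕ) : formalX H 1 (polyG H) k =
    (1 / 2 : ℝ) • (polyY H (k - 1) + X * polyY H (k - 1)) := by
  rw [formalX, formalY_polyG, polyG]
  module

/-- Here `T - 1` is multiplication by `X - 1`, so coefficients in powers of `X - 1` obey
`P_succ_succ`. The free bound `M` allows a common truncation for all earlier iterates. -/
theorem polyY_eq_sum (k : ℕ) : ∀ M, k < M →
    polyY H k = ∑ m ∈ Finset.range M, P H k m • (X - 1 : ℝ[X]) ^ m := by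
  induction k using Nat.strong_induction_on with
  | _ k ih =>
  intro M hM
  obtain ⟨M, rfl⟩ : ∃ M', M = M' + 1 := ⟨M - 1, by omega⟩
  cases k with
  | zero =>
    rw [Finset.sum_range_succ', Finset.sum_eq_zero fun m _ => ?_]
    · simp [P_zero, polyY_zero]
    · simp [P_succ]
  | succ k =>
    have h1 : ∀ j ∈ Finset.range (k + 1),
        entry H (k + 1) (j + 1) • (polyY H j - X * polyY H j) =
          -∑ m ∈ Finset.range M, (entry H (k + 1) (j + 1) * P H j m) • (X - 1 : ℝ[X]) ^ (m + 1) := by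
      intro j hj
      have hj' := Finset.mem_range.1 hj
      have : polyY H j - X * polyY H j = -((X - 1) * polyY H j) := by ring
      rw [this, smul_neg, ih j hj' M (by omega), Finset.mul_sum, Finset.smul_sum]
      congr 1
      refine Finset.sum_congr rfl fun m _ => ?_
      rw [mul_smul_comm, smul_smul, pow_succ']
    rw [polyY_succ, ih k (by omega) (M + 1) (by omega), Finset.sum_congr rfl h1,
      Finset.sum_neg_distrib, sub_neg_eq_add, Finset.sum_comm, Finset.sum_range_succ',
      Finset.sum_range_succ' (fun m => P H (k + 1) m • (X - 1 : ℝ[X]) ^ m), P_zero, P_zero,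
      add_right_comm, ← Finset.sum_add_distrib]
    congr 1
    refine Finset.sum_congr rfl fun m _ => ?_
    rw [P_succ_succ, add_smul, Finset.sum_smul]

theorem polyY_natDegree_le (k : ℕ) : (polyY H k).natDegree ≤ k := by
  rw [polyY_eq_sum H k (k + 1) (by omega)]
  refine natDegree_sum_le_of_forall_le _ _ fun m hm => ?_
  refine (natDegree_smul_le _ _).trans ((natDegree_pow_le).trans ?_)
  have : (X - 1 : ℝ[X]).natDegree = 1 := natDegree_X_sub_C 1
  rw [this]
  have := Finset.mem_range.1 hm
  omega

theorem polyY_coeff_succ (k : ℕ) :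
    (polyY H (k + 1)).coeff (k + 1) = entry H (k + 1) (k + 1) * (polyY H k).coeff k := by
  have h0 : ∀ j l, j < l → (polyY H j).coeff l = 0 := fun j l hjl =>
    coeff_eq_zero_of_natDegree_lt ((polyY_natDegree_le H j).trans_lt hjl)
  rw [polyY_succ, coeff_sub, h0 k _ (by omega), finsetSum_coeff, Finset.sum_range_succ,
    Finset.sum_eq_zero fun j hj => ?_]
  · rw [coeff_smul, coeff_sub, h0 k _ (by omega), coeff_X_mul]
    simp
  · have := Finset.mem_range.1 hj
    rw [coeff_smul, coeff_sub, h0 j _ (by omega), coeff_X_mul, h0 j _ (by omega)]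
    simp

end Model

/-! ### Consequences of H-invariance in the model. -/

section Invariance

variable {N : ℕ} {H : Matrix (Fin (N - 1)) (Fin (N - 1)) ℝ}

/-- The prescribed values, times `N`, are the coefficients of `(X^N - 1) / (X - 1)` in powers of `X
- 1`; the case `m = 0` is automatic. Multiplying by `1 - X` telescopes. -/
theorem natCast_smul_polyG (hN : 1 ≤ N) (hinv : HInvariance N H) :
    (N : ℝ) • polyG H N = (1 / 2 : ℝ) • (1 - X ^ N) := by
  have hN0 : (N : ℝ) ≠ 0 := by positivity
  have h1 : ∀ m ∈ Finset.range N, (N : ℝ) • P H (N - 1) m • (X - 1 : ℝ[X]) ^ m =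
      (N.choose (m + 1) : ℝ) • (X - 1 : ℝ[X]) ^ m := by
    intro m hm
    have hm' := Finset.mem_range.1 hm
    rw [smul_smul]
    congr 1
    cases m with
    | zero => simp [P_zero]
    | succ m => rw [hinv (m + 1) (by omega) (by omega)]; field_simp
  have h2 : (X : ℝ[X]) ^ N = 1 + (X - 1) *
      ∑ m ∈ Finset.range N, (N.choose (m + 1) : ℝ) • (X - 1 : ℝ[X]) ^ m := by
    have h3 := add_pow (X - 1 : ℝ[X]) 1 N
    rw [sub_add_cancel, Finset.sum_range_succ'] at h3
    rw [h3, add_comm, Finset.mul_sum]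
    congr 1
    · simp
    · refine Finset.sum_congr rfl fun m _ => ?_
      rw [mul_smul_comm, Nat.cast_smul_eq_nsmul, nsmul_eq_mul, one_pow]
      ring
  have h4 : (N : ℝ) • polyY H (N - 1) =
      ∑ m ∈ Finset.range N, (N.choose (m + 1) : ℝ) • (X - 1 : ℝ[X]) ^ m := by
    rw [polyY_eq_sum H (N - 1) N (by omega), Finset.smul_sum, Finset.sum_congr rfl h1]
  rw [polyG, smul_comm, smul_sub, ← mul_smul_comm, h4, h2]
  congr 1
  ring

/-- A vanishing leading coefficient would propagate by `polyY_coeff_succ` up to `y_{N-1}`, whose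
leading coefficient is nonzero. Hence `y_0, …, y_{N-1}` have exact degrees and are independent. -/
theorem polyY_coeff_ne_zero (hN : 1 ≤ N) (hinv : HInvariance N H) :
    ∀ k < N, (polyY H k).coeff k ≠ 0 := by
  have hlast : (polyY H (N - 1)).coeff (N - 1) ≠ 0 := by
    have h := congrArg (fun q : ℝ[X] => q.coeff N) (natCast_smul_polyG hN hinv)
    obtain ⟨M, rfl⟩ : ∃ M, N = M + 1 := ⟨N - 1, by omega⟩
    intro h0
    change (polyY H M).coeff M = 0 at h0
    have h1 : (polyY H M).coeff (M + 1) = 0 :=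
      coeff_eq_zero_of_natDegree_lt ((polyY_natDegree_le H M).trans_lt (by omega))
    simp [polyG, coeff_X_mul, h0, h1, coeff_one] at h
  intro k hk
  have : ∀ i, ∀ k, k + i = N - 1 → (polyY H k).coeff k ≠ 0 := by
    intro i
    induction i with
    | zero => intro k hk; rw [show k = N - 1 by omega]; exact hlast
    | succ i ih =>
      intro k hk h0
      exact ih (k + 1) (by omega) (by rw [polyY_coeff_succ, h0, mul_zero])
  exact this (N - 1 - k) k (by omega)

end Invariance

/-! ### Dependence on the starting point, and vanishing vectors. -/

section Translation

variable {E : Type*} [AddCommGroup E] [Module ℝ E] {n : ℕ} (H : Matrix (Fin n) (Fin n) ℝ)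

theorem formalY_eq_add (y0 : E) (g : ℕ → E) (k : ℕ) :
    formalY H y0 g k = y0 + formalY H 0 g k := by
  induction k with
  | zero => simp [formalY]
  | succ k ih => rw [formalY_succ, formalY_succ, ih]; abel

theorem formalX_eq_add (y0 : E) (g : ℕ → E) (k : ℕ) :
    formalX H y0 g k = y0 + formalX H 0 g k := by
  rw [formalX, formalX, formalY_eq_add, add_sub_assoc]

theorem formalY_zero_of_eq_zero {g : ℕ → E} (k : ℕ) (h : ∀ l, 1 ≤ l → l ≤ k → g l = 0) :
    formalY H 0 g k = 0 := by
  rw [formalY_congr H 0 (g' := fun _ => 0) k h]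
  have := formalY_map H (0 : E →ₗ[ℝ] E) 0 g k
  simpa using this

theorem formalX_zero_of_eq_zero {g : ℕ → E} (k : ℕ) (h : ∀ l, 1 ≤ l → l < k → g l = 0) :
    formalX H 0 g k = -g k := by
  rw [formalX, formalY_zero_of_eq_zero H _ fun l hl hl' => h l hl (by omega), zero_sub]

end Translation

/-! ### Pairings as linear functionals of the Gram array. -/

section Gram

/-- The symmetrised entry `(l, m)` of a Gram array, as a linear functional. -/
noncomputable def gramEntry (l m : ℕ) : (ℕ → ℕ → ℝ) →ₗ[ℝ] ℝ :=
  (1 / 2 : ℝ) •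
    ((LinearMap.proj m : (ℕ → ℝ) →ₗ[ℝ] ℝ) ∘ₗ (LinearMap.proj l : (ℕ → ℕ → ℝ) →ₗ[ℝ] ℕ → ℝ) +
      (LinearMap.proj l : (ℕ → ℝ) →ₗ[ℝ] ℝ) ∘ₗ (LinearMap.proj m : (ℕ → ℕ → ℝ) →ₗ[ℝ] ℕ → ℝ))

theorem gramEntry_apply (l m : ℕ) (G : ℕ → ℕ → ℝ) :
    gramEntry l m G = 1 / 2 * (G l m + G m l) := by simp [gramEntry, mul_add]

theorem gramEntry_comm (l m : ℕ) (G : ℕ → ℕ → ℝ) : gramEntry l m G = gramEntry m l G := by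
  rw [gramEntry_apply, gramEntry_apply, add_comm]

variable {n : ℕ} (H : Matrix (Fin n) (Fin n) ℝ)

/-- The functional `⟪x_k - y_0, g_m⟫` of the Gram array of `g`. -/
noncomputable def gramX (k m : ℕ) : (ℕ → ℕ → ℝ) →ₗ[ℝ] ℝ :=
  formalX H 0 (fun l => gramEntry l m) k

/-- The functional `⟪x_k - x_j, g_k - g_j⟫` of the Gram array of `g`. -/
noncomputable def gramPair (k j : ℕ) : (ℕ → ℕ → ℝ) →ₗ[ℝ] ℝ :=
  gramX H k k - gramX H k j - (gramX H j k - gramX H j j)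

theorem gramX_apply (k m : ℕ) (G : ℕ → ℕ → ℝ) :
    gramX H k m G = formalX H 0 (fun l => gramEntry l m G) k := by
  have := formalX_map H (LinearMap.applyₗ (R := ℝ) (M₂ := ℝ) G) 0 (fun l => gramEntry l m) k
  rw [map_zero] at this
  exact this.symm

variable {F : Type*} [AddCommGroup F] [Module ℝ F] (B : F →ₗ[ℝ] F →ₗ[ℝ] ℝ)
  (hB : ∀ x y, B x y = B y x) (y0 : F) (g : ℕ → F)

include hB in
theorem gramEntry_gram (l m : ℕ) : gramEntry l m (fun a b => B (g a) (g b)) = B (g l) (g m) := by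
  rw [gramEntry_apply, hB (g m) (g l)]; ring

include hB in
theorem gramX_gram (k m : ℕ) :
    gramX H k m (fun a b => B (g a) (g b)) = B (formalX H y0 g k - y0) (g m) := by
  rw [gramX_apply, formalX_eq_add H y0, add_sub_cancel_left]
  simp only [gramEntry_gram B hB]
  have := formalX_map H (B.flip (g m)) 0 g k
  rw [map_zero] at this
  exact this

include hB in
theorem gramPair_gram (k j : ℕ) : gramPair H k j (fun a b => B (g a) (g b)) =
    B (formalX H y0 g k - formalX H y0 g j) (g k - g j) := by
  simp only [gramPair, LinearMap.sub_apply, gramX_gram H B hB y0, map_sub]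
  ring

end Gram

/-! ### Shift-invariant (Toeplitz) forms on polynomials. -/

section ShiftInvariant

/-- A symmetric bilinear form on `ℝ[X]` for which multiplication by `X` is an isometry. -/
structure IsShiftInvariant (B : ℝ[X] →ₗ[ℝ] ℝ[X] →ₗ[ℝ] ℝ) : Prop where
  symm : ∀ p q, B p q = B q p
  shift : ∀ p q, B (X * p) (X * q) = B p q

variable {n : ℕ} (H : Matrix (Fin n) (Fin n) ℝ)

/-- With `q = y_{k-1} - y_{j-1}` the pairing is `(B(q, q) - B(Xq, Xq)) / 4`. -/
theorem IsShiftInvariant.pair_eq_zero {B : ℝ[X] →ₗ[ℝ] ℝ[X] →ₗ[ℝ] ℝ} (hB : IsShiftInvariant B)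
    (k j : ℕ) :
    B (formalX H 1 (polyG H) k - formalX H 1 (polyG H) j) (polyG H k - polyG H j) = 0 := by
  have h := hB.shift (polyY H (k - 1) - polyY H (j - 1)) (polyY H (k - 1) - polyY H (j - 1))
  have h' := hB.symm (X * (polyY H (k - 1) - polyY H (j - 1))) (polyY H (k - 1) - polyY H (j - 1))
  have e1 : formalX H 1 (polyG H) k - formalX H 1 (polyG H) j =
      (1 / 2 : ℝ) • ((polyY H (k - 1) - polyY H (j - 1)) +
        X * (polyY H (k - 1) - polyY H (j - 1))) := by
    rw [formalX_polyG, formalX_polyG, mul_sub]; module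
  have e2 : polyG H k - polyG H j =
      (1 / 2 : ℝ) • ((polyY H (k - 1) - polyY H (j - 1)) -
        X * (polyY H (k - 1) - polyY H (j - 1))) := by
    rw [polyG, polyG, mul_sub]; module
  rw [e1, e2]
  generalize polyY H (k - 1) - polyY H (j - 1) = q at *
  simp only [map_smul, map_add, map_sub, LinearMap.smul_apply, LinearMap.add_apply, h, h', smul_eq_mul]
  ring

theorem IsShiftInvariant.fix_eq_zero {B : ℝ[X] →ₗ[ℝ] ℝ[X] →ₗ[ℝ] ℝ} (hB : IsShiftInvariant B)
    (k : ℕ) : B (formalX H 1 (polyG H) k) (polyG H k) = 0 := by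
  have h := hB.shift (polyY H (k - 1)) (polyY H (k - 1))
  have h' := hB.symm (X * polyY H (k - 1)) (polyY H (k - 1))
  rw [formalX_polyG, polyG]
  simp only [map_smul, map_add, map_sub, LinearMap.smul_apply, LinearMap.add_apply, h, h', smul_eq_mul]
  ring

/-- The form `(p, q) ↦ ∑ a, p_a q_{a+m}`. -/
noncomputable def shiftPairing (m : ℕ) : ℝ[X] →ₗ[ℝ] ℝ[X] →ₗ[ℝ] ℝ :=
  (Polynomial.basisMonomials ℝ).constr ℝ fun a => lcoeff ℝ (a + m)

theorem shiftPairing_monomial (m a : ℕ) (q : ℝ[X]) :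
    shiftPairing m (monomial a 1) q = q.coeff (a + m) := by
  have := (Polynomial.basisMonomials ℝ).constr_basis ℝ (fun a => lcoeff ℝ (a + m)) a
  rw [coe_basisMonomials] at this
  exact congrArg (fun f : ℝ[X] →ₗ[ℝ] ℝ => f q) this

theorem shiftPairing_X_mul (m : ℕ) (p q : ℝ[X]) :
    shiftPairing m (X * p) (X * q) = shiftPairing m p q := by
  have : (shiftPairing m).flip (X * q) ∘ₗ LinearMap.mulLeft ℝ X = (shiftPairing m).flip q := by
    refine (Polynomial.basisMonomials ℝ).ext fun a => ?_
    simp only [coe_basisMonomials, LinearMap.comp_apply, LinearMap.mulLeft_apply,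
      LinearMap.flip_apply, X_mul_monomial, shiftPairing_monomial]
    rw [add_right_comm, coeff_X_mul]
  exact congrArg (fun f : ℝ[X] →ₗ[ℝ] ℝ => f p) this

theorem shiftPairing_eq_zero {m : ℕ} (p : ℝ[X]) {q : ℝ[X]} (hq : q.natDegree < m) :
    shiftPairing m p q = 0 := by
  have : (shiftPairing m).flip q = 0 := by
    refine (Polynomial.basisMonomials ℝ).ext fun a => ?_
    simp only [coe_basisMonomials, LinearMap.flip_apply, shiftPairing_monomial,
      LinearMap.zero_apply]
    exact coeff_eq_zero_of_natDegree_lt (by omega)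
  exact congrArg (fun f : ℝ[X] →ₗ[ℝ] ℝ => f p) this

theorem shiftPairing_one (m : ℕ) (q : ℝ[X]) : shiftPairing m 1 q = q.coeff m := by
  have := shiftPairing_monomial m 0 q
  rwa [zero_add, monomial_zero_one] at this

/-- Adjusts the moment `B(1, X^m)` freely without affecting polynomials of degree below `m`. -/
theorem IsShiftInvariant.add_shiftPairing {B : ℝ[X] →ₗ[ℝ] ℝ[X] →ₗ[ℝ] ℝ}
    (hB : IsShiftInvariant B) (c : ℝ) (m : ℕ) :
    IsShiftInvariant (B + c • (shiftPairing m + (shiftPairing m).flip)) := by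
  constructor <;> intro p q
  · simp only [LinearMap.add_apply, LinearMap.smul_apply, LinearMap.flip_apply, hB.symm p q]
    ring
  · simp only [LinearMap.add_apply, LinearMap.smul_apply, LinearMap.flip_apply, hB.shift,
      shiftPairing_X_mul]

theorem polyG_natDegree_le {k : ℕ} (hk : 1 ≤ k) : (polyG H k).natDegree ≤ k := by
  have h := polyY_natDegree_le H (k - 1)
  refine (natDegree_smul_le _ _).trans ((natDegree_sub_le _ _).trans (max_le (by omega) ?_))
  refine (natDegree_mul_le).trans ?_
  rw [natDegree_X]
  omega

end ShiftInvariant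

/-! ### Existence of the certificates by duality. -/

section Existence

variable {N : ℕ} {H : Matrix (Fin (N - 1)) (Fin (N - 1)) ℝ}

/-- A Gram array on which all pairings vanish is that of `polyG` for a shift invariant form. -/
theorem exists_isShiftInvariant_of_gramPair_eq_zero (hN : 1 ≤ N) (hinv : HInvariance N H)
    (G : ℕ → ℕ → ℝ) (hG : ∀ k j, 1 ≤ j → j < k → k ≤ N → gramPair H k j G = 0) :
    ∀ n ≤ N, ∃ B, IsShiftInvariant B ∧ ∀ k l, 1 ≤ k → k ≤ n → 1 ≤ l → l ≤ n →
      gramEntry k l G = B (polyG H k) (polyG H l) := by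
  intro n
  induction n with
  | zero =>
    intro _
    exact ⟨0, ⟨fun _ _ => rfl, fun _ _ => rfl⟩, fun k l hk hk' => by omega⟩
  | succ n ih =>
    intro hn
    obtain ⟨B₀, hB₀, hBG⟩ := ih (by omega)
    have hlead : (polyG H (n + 1)).coeff (n + 1) ≠ 0 := by
      have h1 := polyY_coeff_ne_zero hN hinv n (by omega)
      have h2 : (polyY H n).coeff (n + 1) = 0 :=
        coeff_eq_zero_of_natDegree_lt ((polyY_natDegree_le H n).trans_lt (by omega))
      simpa [polyG, h2] using h1
    -- Shift invariance gives `B(x_{n+1}, g_{n+1}) = 0`, so matching `⟪x_{n+1} - y_0, g_{n+1}⟫` is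
    -- one condition on `B(1, g_{n+1})`, met by choosing the new moment.
    obtain ⟨c, hc⟩ : ∃ c : ℝ, B₀ 1 (polyG H (n + 1)) + c * (polyG H (n + 1)).coeff (n + 1) =
        -gramX H (n + 1) (n + 1) G :=
      ⟨(-gramX H (n + 1) (n + 1) G - B₀ 1 (polyG H (n + 1))) / (polyG H (n + 1)).coeff (n + 1),
        by field_simp; ring⟩
    let B := B₀ + c • (shiftPairing (n + 1) + (shiftPairing (n + 1)).flip)
    have hB : IsShiftInvariant B := hB₀.add_shiftPairing c (n + 1)
    have hBapp : ∀ p q, B p q =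
        B₀ p q + c * (shiftPairing (n + 1) p q + shiftPairing (n + 1) q p) := fun p q => by
      simp [B, mul_add]
    have hB1 : B 1 (polyG H (n + 1)) = -gramX H (n + 1) (n + 1) G := by
      rw [hBapp, shiftPairing_one, shiftPairing_eq_zero _ (by simp), add_zero, hc]
    let f : ℕ → ℕ → ℝ := fun l m => gramEntry l m G - B (polyG H l) (polyG H m)
    have hfsymm : ∀ l m, f l m = f m l := fun l m => by
      simp only [f, gramEntry_comm l m, hB.symm (polyG H l)]
    have hf0 : ∀ l m, 1 ≤ l → l ≤ n → 1 ≤ m → m ≤ n → f l m = 0 := by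
      intro l m hl hl' hm hm'
      have h1 := polyG_natDegree_le H hl
      have h2 := polyG_natDegree_le H hm
      simp only [f]
      rw [hBapp, hBG l m hl hl' hm hm', shiftPairing_eq_zero _ (by omega),
        shiftPairing_eq_zero _ (by omega)]
      ring
    have hξ : ∀ k m, formalX H 0 (fun l => f l m) k = gramX H k m G -
        B (formalX H 1 (polyG H) k - 1) (polyG H m) := by
      intro k m
      have h1 := formalX_add_smul H (0 : ℝ) (fun l => gramEntry l m G)
        (fun l => B (polyG H l) (polyG H m)) (-1) k
      rw [gramX_apply, ← gramX_gram H B hB.symm 1 (polyG H), gramX_apply]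
      simp only [gramEntry_gram B hB.symm]
      simp only [neg_smul, one_smul, ← sub_eq_add_neg] at h1
      exact h1
    have hpair : ∀ j, 1 ≤ j → j ≤ n →
        formalX H 0 (fun l => f l (n + 1)) (n + 1) - formalX H 0 (fun l => f l j) (n + 1) -
          (formalX H 0 (fun l => f l (n + 1)) j - formalX H 0 (fun l => f l j) j) = 0 := by
      intro j hj hj'
      have h1 := hG (n + 1) j hj (by omega) hn
      have h2 := hB.pair_eq_zero H (n + 1) j
      simp only [gramPair, LinearMap.sub_apply] at h1
      simp only [map_sub, LinearMap.sub_apply] at h2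
      simp only [hξ, map_sub, LinearMap.sub_apply]
      linarith
    have hdiag : formalX H 0 (fun l => f l (n + 1)) (n + 1) = 0 := by
      rw [hξ, map_sub, LinearMap.sub_apply, hB.fix_eq_zero, hB1]
      ring
    -- All other terms of `hpair` vanish by `hdiag`, the induction hypotheses and `hf0`; what
    -- remains is `2 f j (n + 1) = 0`.
    have hrow : ∀ j, 1 ≤ j → j ≤ n → f j (n + 1) = 0 := by
      intro j
      induction j using Nat.strong_induction_on with
      | _ j ihj =>
      intro hj hj'
      have h1 := hpair j hj hj'
      rw [hdiag,
        formalX_zero_of_eq_zero H (n + 1) fun l hl hl' => hf0 l j hl (by omega) hj hj',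
        formalX_zero_of_eq_zero H j fun l hl hl' => ihj l hl' hl (by omega),
        formalX_zero_of_eq_zero H j fun l hl hl' => hf0 l j hl (by omega) hj hj',
        hf0 j j hj hj' hj hj', hfsymm (n + 1) j] at h1
      linarith
    have hlast : f (n + 1) (n + 1) = 0 := by
      rw [formalX_zero_of_eq_zero H (n + 1) fun l hl hl' => hrow l hl (by omega)] at hdiag
      linarith
    refine ⟨B, hB, fun k l hk hk' hl hl' => sub_eq_zero.1 (?_ : f k l = 0)⟩
    rcases Nat.lt_or_eq_of_le hk' with h1 | rfl <;> rcases Nat.lt_or_eq_of_le hl' with h2 | rfl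
    · exact hf0 k l hk (by omega) hl (by omega)
    · exact hrow k hk (by omega)
    · rw [hfsymm]; exact hrow l hl (by omega)
    · exact hlast

/-- For the shift-invariant form representing `G` the objective is `N B(g_N, g_N) - B(1, g_N)`. With
`g_N = (1 - X^N) / (2N)` both terms equal `(B(1, 1) - B(1, X^N)) / (2N)`. -/
theorem gram_objective_eq_zero (hN : 1 ≤ N) (hinv : HInvariance N H)
    (G : ℕ → ℕ → ℝ) (hG : ∀ k j, 1 ≤ j → j < k → k ≤ N → gramPair H k j G = 0) :
    N * gramEntry N N G + gramX H N N G = 0 := by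
  obtain ⟨B, hB, hBG⟩ :=
    exists_isShiftInvariant_of_gramPair_eq_zero hN hinv G hG N le_rfl
  have h1 : gramX H N N G = B (formalX H 1 (polyG H) N - 1) (polyG H N) := by
    rw [← gramX_gram H B hB.symm, gramX_apply, gramX_apply]
    refine formalX_congr H _ N hN fun l hl hl' => ?_
    rw [hBG l N hl hl' hN le_rfl, gramEntry_gram B hB.symm]
  have hpow : ∀ k : ℕ, B (X ^ k) (X ^ k) = B 1 1 := by
    intro k
    induction k with
    | zero => simp
    | succ k ih => rw [pow_succ', hB.shift, ih]
  have hN0 : (N : ℝ) ≠ 0 := by positivity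
  rw [h1, hBG N N hN le_rfl hN le_rfl, map_sub, LinearMap.sub_apply, hB.fix_eq_zero]
  have h2 : polyG H N = (1 / (2 * N) : ℝ) • (1 - X ^ N) := by
    have := congrArg (fun q : ℝ[X] => (1 / N : ℝ) • q) (natCast_smul_polyG hN hinv)
    simp only [smul_smul] at this
    rw [one_div_mul_cancel hN0, one_smul] at this
    rw [this]
    congr 1
    field_simp
  have h3 := hB.symm (X ^ N) 1
  rw [h2]
  simp only [map_smul, map_sub, LinearMap.smul_apply, LinearMap.sub_apply, hpow, h3, smul_eq_mul]
  field_simp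
  ring

/-- A functional vanishing on the common kernel of finitely many functionals lies in their span. The
array `G` is arbitrary, so no positivity is involved. -/
theorem exists_isCertificate (hN : 1 ≤ N) (hinv : HInvariance N H) :
    ∃ lam, IsCertificate N H lam := by
  classical
  let S : Finset (Σ _ : ℕ, ℕ) := (Finset.Icc 1 N).sigma fun k => Finset.Ico 1 k
  have hS : ∀ k j, (⟨k, j⟩ : Σ _ : ℕ, ℕ) ∈ S ↔ 1 ≤ j ∧ j < k ∧ k ≤ N := by
    intro k j
    simp only [S, Finset.mem_sigma, Finset.mem_Icc, Finset.mem_Ico]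
    omega
  have hspan : (N : ℝ) • gramEntry N N + gramX H N N ∈
      Submodule.span ℝ (Set.range fun a : S => gramPair H a.1.1 a.1.2) := by
    refine mem_span_of_iInf_ker_le_ker fun G hG => ?_
    rw [Submodule.mem_iInf] at hG
    exact gram_objective_eq_zero hN hinv G fun k j h1 h2 h3 =>
      hG ⟨⟨k, j⟩, (hS k j).2 ⟨h1, h2, h3⟩⟩
  obtain ⟨c, hc⟩ := (Submodule.mem_span_range_iff_exists_fun ℝ).1 hspan
  refine ⟨fun k j => if h : (⟨k, j⟩ : Σ _ : ℕ, ℕ) ∈ S then -c ⟨⟨k, j⟩, h⟩ else 0, ?_, ?_⟩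
  · intro k j h
    exact dif_neg (mt (hS k j).1 h)
  · intro d y0 g
    have hsymm : ∀ x y, innerₗ (EuclideanSpace ℝ (Fin d)) x y = innerₗ _ y x := fun x y => by
      simp only [innerₗ_apply_apply, real_inner_comm]
    have h := congrArg
      (fun L : (ℕ → ℕ → ℝ) →ₗ[ℝ] ℝ => L fun a b => innerₗ _ (g a) (g b)) hc
    simp only [LinearMap.sum_apply, LinearMap.smul_apply, LinearMap.add_apply,
      gramPair_gram H _ hsymm y0, gramX_gram H _ hsymm y0, gramEntry_gram _ hsymm,
      smul_eq_mul] at h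
    simp only [innerₗ_apply_apply, real_inner_self_eq_norm_sq] at h
    rw [real_inner_comm, ← h, Finset.sum_sigma' (Finset.Icc 1 N) (fun k => Finset.Ico 1 k),
      ← Finset.sum_coe_sort S, ← Finset.sum_add_distrib, eq_comm]
    refine Finset.sum_eq_zero fun a _ => ?_
    rw [dif_pos a.2]
    ring

end Existence

/-! ### The negacyclic shift, a worst-case isometry. -/

section Base

/-- The orbit of the first basis vector under a negacyclic shift of the first `N` coordinates. -/
noncomputable def orbit (N : ℕ) (i : ℕ) : EuclideanSpace ℝ (Fin (N + 1)) :=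
  (-1 : ℝ) ^ (i / N) • EuclideanSpace.single (Fin.ofNat (N + 1) (i % N)) (1 : ℝ)

theorem inner_orbit {N : ℕ} (hN : 1 ≤ N) (a b : ℕ) : inner ℝ (orbit N a) (orbit N b) =
    if a % N = b % N then (-1 : ℝ) ^ (a / N + b / N) else 0 := by
  have ha := Nat.mod_lt a hN
  have hb := Nat.mod_lt b hN
  have : (Fin.ofNat (N + 1) (a % N) = Fin.ofNat (N + 1) (b % N)) ↔ a % N = b % N := by
    rw [Fin.ext_iff, Fin.val_ofNat, Fin.val_ofNat,
      Nat.mod_eq_of_lt (show a % N < N + 1 by omega),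
      Nat.mod_eq_of_lt (show b % N < N + 1 by omega)]
  rw [orbit, orbit, real_inner_smul_left, real_inner_smul_right,
    EuclideanSpace.inner_single_left]
  by_cases h : a % N = b % N
  · simp [h, pow_add]
  · have hne := mt this.1 h
    generalize Fin.ofNat (N + 1) (a % N) = i at hne
    generalize Fin.ofNat (N + 1) (b % N) = j at hne
    simp [h, hne]

/-- When the residues agree, `a / N` and `b / N` jump simultaneously, so the two sign changes
cancel. -/
theorem inner_orbit_succ {N : ℕ} (hN : 1 ≤ N) (a b : ℕ) :
    inner ℝ (orbit N (a + 1)) (orbit N (b + 1)) = inner ℝ (orbit N a) (orbit N b) := by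
  have hmod : (a + 1) % N = (b + 1) % N ↔ a % N = b % N :=
    ⟨fun h => Nat.ModEq.add_right_cancel' 1 h, fun h => Nat.ModEq.add_right 1 h⟩
  rw [inner_orbit hN, inner_orbit hN]
  by_cases h : a % N = b % N
  · rw [if_pos h, if_pos (hmod.2 h), Nat.succ_div, Nat.succ_div]
    have hdvd : N ∣ a + 1 ↔ N ∣ b + 1 := by
      rw [Nat.dvd_iff_mod_eq_zero, Nat.dvd_iff_mod_eq_zero, hmod.2 h]
    by_cases hd : N ∣ b + 1
    · rw [if_pos hd, if_pos (hdvd.2 hd)]; ring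
    · rw [if_neg hd, if_neg (mt hdvd.1 hd)]; ring
  · rw [if_neg h, if_neg (mt hmod.1 h)]

theorem orbit_self {N : ℕ} (hN : 1 ≤ N) : orbit N N = -orbit N 0 := by
  simp [orbit, Nat.div_self hN]

/-- The linear map `X ^ i ↦ orbit N i`. -/
noncomputable def orbitMap (N : ℕ) : ℝ[X] →ₗ[ℝ] EuclideanSpace ℝ (Fin (N + 1)) :=
  (Polynomial.basisMonomials ℝ).constr ℝ (orbit N)

theorem orbitMap_monomial (N i : ℕ) : orbitMap N (monomial i 1) = orbit N i := by
  have := (Polynomial.basisMonomials ℝ).constr_basis ℝ (orbit N) i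
  rwa [coe_basisMonomials] at this

theorem orbitMap_one (N : ℕ) : orbitMap N 1 = orbit N 0 := by
  rw [← monomial_zero_one, orbitMap_monomial]

/-- The pullback of the inner product along `orbitMap`. -/
noncomputable def orbitForm (N : ℕ) : ℝ[X] →ₗ[ℝ] ℝ[X] →ₗ[ℝ] ℝ :=
  (innerₗ (EuclideanSpace ℝ (Fin (N + 1)))).compl₁₂ (orbitMap N) (orbitMap N)

theorem orbitForm_apply (N : ℕ) (p q : ℝ[X]) :
    orbitForm N p q = inner ℝ (orbitMap N p) (orbitMap N q) := rfl

theorem isShiftInvariant_orbitForm {N : ℕ} (hN : 1 ≤ N) : IsShiftInvariant (orbitForm N) where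
  symm p q := by rw [orbitForm_apply, orbitForm_apply, real_inner_comm]
  shift p q := by
    have : (orbitForm N).compl₁₂ (LinearMap.mulLeft ℝ X) (LinearMap.mulLeft ℝ X) =
        orbitForm N := by
      refine (Polynomial.basisMonomials ℝ).ext fun a => (Polynomial.basisMonomials ℝ).ext
        fun b => ?_
      simp only [coe_basisMonomials, LinearMap.compl₁₂_apply, LinearMap.mulLeft_apply,
        X_mul_monomial, orbitForm_apply, orbitMap_monomial, inner_orbit_succ hN]
    exact congrArg (fun B : ℝ[X] →ₗ[ℝ] ℝ[X] →ₗ[ℝ] ℝ => B p q) this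

theorem norm_orbit_zero {N : ℕ} (hN : 1 ≤ N) : ‖orbit N 0‖ = 1 := by
  have h := inner_orbit hN 0 0
  rw [real_inner_self_eq_norm_sq, if_pos rfl, Nat.zero_div, add_zero, pow_zero] at h
  exact (pow_eq_one_iff_of_nonneg (norm_nonneg _) two_ne_zero).1 h

/-- A vector with prescribed inner products with `X q`, for `q` of degree less than `N`. -/
theorem exists_inner_orbitMap_X_mul {N : ℕ} (hN : 1 ≤ N) (f : ℝ[X] →ₗ[ℝ] ℝ) :
    ∃ d : EuclideanSpace ℝ (Fin (N + 1)), ∀ q : ℝ[X], q.natDegree < N →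
      inner ℝ d (orbitMap N (X * q)) = f q := by
  refine ⟨∑ i ∈ Finset.range N, f (monomial i 1) • orbit N (i + 1), fun q hq => ?_⟩
  have hmon : ∀ a < N, inner ℝ (∑ i ∈ Finset.range N, f (monomial i 1) • orbit N (i + 1))
      (orbitMap N (X * monomial a 1)) = f (monomial a 1) := by
    intro a ha
    rw [X_mul_monomial, orbitMap_monomial, sum_inner, Finset.sum_eq_single a]
    · rw [real_inner_smul_left, inner_orbit_succ hN, inner_orbit hN, if_pos rfl,
        Nat.div_eq_of_lt ha]
      simp
    · intro i hi hia
      have hi' := Finset.mem_range.1 hi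
      rw [real_inner_smul_left, inner_orbit_succ hN, inner_orbit hN, if_neg, mul_zero]
      rwa [Nat.mod_eq_of_lt hi', Nat.mod_eq_of_lt ha]
    · intro h
      exact absurd (Finset.mem_range.2 ha) h
  conv_lhs => rw [q.as_sum_range' N hq]
  conv_rhs => rw [q.as_sum_range' N hq]
  rw [Finset.mul_sum, map_sum, map_sum, inner_sum]
  refine Finset.sum_congr rfl fun a ha => ?_
  have : (monomial a (q.coeff a) : ℝ[X]) = q.coeff a • monomial a 1 := by
    rw [smul_monomial, smul_eq_mul, mul_one]
  rw [this, mul_smul_comm, map_smul, map_smul, real_inner_smul_right,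
    hmon a (Finset.mem_range.1 ha), smul_eq_mul]

end Base

/-! ### First-order perturbations of the worst case. -/

section Perturbation

variable {N : ℕ} {H : Matrix (Fin (N - 1)) (Fin (N - 1)) ℝ}

/-- Triangular interpolation: the coefficient of `X^n` vanishes on `y_k` for `k < n` but not on
`y_n`. -/
theorem exists_linearMap_polyY (hN : 1 ≤ N) (hinv : HInvariance N H) (r : ℕ → ℝ) :
    ∀ n ≤ N, ∃ f : ℝ[X] →ₗ[ℝ] ℝ, ∀ k < n, f (polyY H k) = r k := by
  intro n
  induction n with
  | zero => exact fun _ => ⟨0, fun k hk => by omega⟩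
  | succ n ih =>
    intro hn
    obtain ⟨f, hf⟩ := ih (by omega)
    have hlead := polyY_coeff_ne_zero hN hinv n (by omega)
    refine ⟨f + ((r n - f (polyY H n)) / (polyY H n).coeff n) • lcoeff ℝ n, fun k hk => ?_⟩
    rw [LinearMap.add_apply, LinearMap.smul_apply, lcoeff_apply, smul_eq_mul]
    rcases Nat.lt_succ_iff_lt_or_eq.1 hk with h | rfl
    · rw [hf k h, coeff_eq_zero_of_natDegree_lt ((polyY_natDegree_le H k).trans_lt h)]
      ring
    · field_simp
      ring

/-- The vectors `g_k` of the worst-case instance. -/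
noncomputable def baseG (N : ℕ) (H : Matrix (Fin (N - 1)) (Fin (N - 1)) ℝ) (k : ℕ) :
    EuclideanSpace ℝ (Fin (N + 1)) := orbitMap N (polyG H k)

/-- The points `x_k` of the worst-case instance. -/
noncomputable def baseX (N : ℕ) (H : Matrix (Fin (N - 1)) (Fin (N - 1)) ℝ) (k : ℕ) :
    EuclideanSpace ℝ (Fin (N + 1)) := formalX H (orbit N 0) (baseG N H) k

theorem baseX_eq (k : ℕ) : baseX N H k = orbitMap N (formalX H 1 (polyG H) k) := by
  rw [baseX, ← orbitMap_one, ← formalX_map]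
  rfl

theorem baseX_sub_baseG (k : ℕ) : baseX N H k - baseG N H k = orbitMap N (X * polyY H (k - 1)) := by
  rw [baseX_eq, baseG, ← map_sub, formalX_polyG, polyG]
  congr 1
  module

theorem inner_baseX_sub (hN : 1 ≤ N) (k j : ℕ) :
    inner ℝ (baseX N H k - baseX N H j) (baseG N H k - baseG N H j) = 0 := by
  rw [baseX_eq, baseX_eq, baseG, baseG, ← map_sub, ← map_sub]
  exact (isShiftInvariant_orbitForm hN).pair_eq_zero H k j

theorem inner_baseX (hN : 1 ≤ N) (k : ℕ) : inner ℝ (baseX N H k) (baseG N H k) = 0 := by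
  rw [baseX_eq, baseG]
  exact (isShiftInvariant_orbitForm hN).fix_eq_zero H k

/-- Since `X^N ↦ -y_0`, the vector `(1 - X^N) / 2` becomes `y_0`; the residual `2 g_N` thus has norm
exactly `2 / N`. -/
theorem natCast_smul_baseG (hN : 1 ≤ N) (hinv : HInvariance N H) :
    (N : ℝ) • baseG N H N = orbit N 0 := by
  rw [baseG, ← map_smul, natCast_smul_polyG hN hinv, map_smul, map_sub, orbitMap_one,
    ← monomial_one_right_eq_X_pow, orbitMap_monomial, orbit_self hN]
  module

/-- First-order perturbations of the worst-case instance realise arbitrary first-order changes of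
the pairings. -/
theorem exists_perturbation (hN : 1 ≤ N) (hinv : HInvariance N H) (t : ℕ → ℕ → ℝ) (s : ℕ → ℝ) :
    ∀ n ≤ N, ∃ d : ℕ → EuclideanSpace ℝ (Fin (N + 1)), ∀ k, 1 ≤ k → k ≤ n →
      (∀ j, 1 ≤ j → j < k →
        inner ℝ (formalX H 0 d k - formalX H 0 d j) (baseG N H k - baseG N H j) +
          inner ℝ (baseX N H k - baseX N H j) (d k - d j) = t k j) ∧
      inner ℝ (formalX H 0 d k) (baseG N H k) + inner ℝ (baseX N H k) (d k) = s k := by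
  intro n
  induction n with
  | zero => exact fun _ => ⟨0, fun k hk hk' => by omega⟩
  | succ n ih =>
    intro hn
    obtain ⟨d, hd⟩ := ih (by omega)
    let Y := formalY H 0 d n
    -- The new `δ` enters `x_{n+1}` as `-δ` and `g_{n+1}` as `δ`, so it meets the equations only
    -- through `⟪δ, x_i - g_i⟫ = ⟪δ, T y_{i-1}⟫`. `R` solves the fixed-point equation (`i = n + 1`);
    -- `r` then solves the others, its index shifted by one.
    let R := s (n + 1) - inner ℝ Y (baseG N H (n + 1))
    let r : ℕ → ℝ := fun i => if i = n then R else
      R - (t (n + 1) (i + 1) -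
        inner ℝ (Y - formalX H 0 d (i + 1)) (baseG N H (n + 1) - baseG N H (i + 1)) +
        inner ℝ (baseX N H (n + 1) - baseX N H (i + 1)) (d (i + 1)))
    obtain ⟨f, hf⟩ := exists_linearMap_polyY hN hinv r N le_rfl
    obtain ⟨δ, hδ⟩ := exists_inner_orbitMap_X_mul hN f
    have hδr : ∀ i < N, inner ℝ δ (baseX N H (i + 1) - baseG N H (i + 1)) = r i := by
      intro i hi
      rw [baseX_sub_baseG, Nat.add_sub_cancel,
        hδ _ ((polyY_natDegree_le H i).trans_lt hi), hf i hi]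
    let d' := Function.update d (n + 1) δ
    have hd' : ∀ l, l ≤ n → d' l = d l := fun l hl => Function.update_of_ne (by omega) _ _
    have hdn : d' (n + 1) = δ := Function.update_self _ _ _
    have hX : ∀ k, 1 ≤ k → k ≤ n → formalX H 0 d' k = formalX H 0 d k := fun k hk hk' =>
      formalX_congr H 0 k hk fun l _ hl => hd' l (by omega)
    have hXn : formalX H 0 d' (n + 1) = Y - δ := by
      rw [formalX, hdn, Nat.add_sub_cancel, formalY_congr H 0 n fun l _ hl => hd' l hl]
    have hRn := hδr n (by omega)
    have hrn : r n = R := if_pos rfl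
    rw [hrn] at hRn
    refine ⟨d', fun k hk hk' => ?_⟩
    rcases Nat.lt_or_eq_of_le hk' with h | rfl
    · rw [hX k hk (by omega), hd' k (by omega)]
      refine ⟨fun j hj hjk => ?_, (hd k hk (by omega)).2⟩
      rw [hX j hj (by omega), hd' j (by omega)]
      exact (hd k hk (by omega)).1 j hj hjk
    · rw [hXn, hdn]
      constructor
      · intro j hj hjk
        rw [hX j hj (by omega), hd' j (by omega)]
        obtain ⟨i, rfl⟩ : ∃ i, j = i + 1 := ⟨j - 1, by omega⟩
        have hRi := hδr i (by omega)
        have hri : r i = R - (t (n + 1) (i + 1) -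
            inner ℝ (Y - formalX H 0 d (i + 1)) (baseG N H (n + 1) - baseG N H (i + 1)) +
            inner ℝ (baseX N H (n + 1) - baseX N H (i + 1)) (d (i + 1))) := if_neg (by omega)
        rw [hri] at hRi
        have e1 : Y - δ - formalX H 0 d (i + 1) = (Y - formalX H 0 d (i + 1)) - δ := by abel
        rw [e1, inner_sub_left (Y - formalX H 0 d (i + 1)), inner_sub_right _ δ]
        rw [real_inner_comm δ (baseX N H (n + 1) - baseX N H (i + 1))]
        have e2 : inner ℝ δ (baseX N H (n + 1) - baseX N H (i + 1)) -
            inner ℝ δ (baseG N H (n + 1) - baseG N H (i + 1)) =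
            inner ℝ δ (baseX N H (n + 1) - baseG N H (n + 1)) -
            inner ℝ δ (baseX N H (i + 1) - baseG N H (i + 1)) := by
          simp only [inner_sub_right]; ring
        linarith
      · rw [inner_sub_left, real_inner_comm δ (baseX N H (n + 1))]
        rw [inner_sub_right] at hRn
        have : R = s (n + 1) - inner ℝ Y (baseG N H (n + 1)) := rfl
        linarith

end Perturbation

/-! ### Uniqueness of the certificates. -/

section Uniqueness

variable {N : ℕ} {H : Matrix (Fin (N - 1)) (Fin (N - 1)) ℝ}

/-- The pairings along a line of instances through the worst-case instance. -/
theorem exists_perturbed_pairings (hN : 1 ≤ N) (hinv : HInvariance N H) (t : ℕ → ℕ → ℝ)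
    (s : ℕ → ℝ) : ∃ (d : ℕ → EuclideanSpace ℝ (Fin (N + 1))) (r : ℕ → ℕ → ℝ) (r' : ℕ → ℝ),
      ∀ ε : ℝ, ∀ k, 1 ≤ k → k ≤ N →
        (∀ j, 1 ≤ j → j < k →
          inner ℝ (formalX H (orbit N 0) (fun l => baseG N H l + ε • d l) k -
            formalX H (orbit N 0) (fun l => baseG N H l + ε • d l) j)
            ((baseG N H k + ε • d k) - (baseG N H j + ε • d j)) = ε * t k j + ε ^ 2 * r k j) ∧
        inner ℝ (formalX H (orbit N 0) (fun l => baseG N H l + ε • d l) k)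
          (baseG N H k + ε • d k) = ε * s k + ε ^ 2 * r' k := by
  obtain ⟨d, hd⟩ := exists_perturbation hN hinv t s N le_rfl
  have expand : ∀ (ε : ℝ) (a b e f : EuclideanSpace ℝ (Fin (N + 1))),
      inner ℝ (a + ε • b) (e + ε • f) = inner ℝ a e + ε * (inner ℝ b e + inner ℝ a f) +
        ε ^ 2 * inner ℝ b f := by
    intro ε a b e f
    simp only [inner_add_left, inner_add_right, real_inner_smul_left, real_inner_smul_right]
    ring
  refine ⟨d, fun k j => inner ℝ (formalX H 0 d k - formalX H 0 d j) (d k - d j),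
    fun k => inner ℝ (formalX H 0 d k) (d k), fun ε k hk hk' => ⟨fun j hj hjk => ?_, ?_⟩⟩
  · have e1 : formalX H (orbit N 0) (fun l => baseG N H l + ε • d l) k -
        formalX H (orbit N 0) (fun l => baseG N H l + ε • d l) j =
        (baseX N H k - baseX N H j) + ε • (formalX H 0 d k - formalX H 0 d j) := by
      rw [formalX_add_smul, formalX_add_smul, baseX, baseX]
      module
    have e2 : (baseG N H k + ε • d k) - (baseG N H j + ε • d j) =
        (baseG N H k - baseG N H j) + ε • (d k - d j) := by module
    rw [e1, e2, expand, inner_baseX_sub hN, (hd k hk hk').1 j hj hjk, zero_add]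
  · rw [formalX_add_smul, ← baseX, expand, inner_baseX hN, (hd k hk hk').2, zero_add]

/-- Perturb so that the pairings move at the rates `lam - mu`: the linear coefficient of the
difference of the two identities is the sum of squares of `lam - mu`. -/
theorem IsCertificate.eq (hN : 1 ≤ N) (hinv : HInvariance N H) {lam mu : ℕ → ℕ → ℝ}
    (hlam : IsCertificate N H lam) (hmu : IsCertificate N H mu) : lam = mu := by
  obtain ⟨d, r, _, hr⟩ :=
    exists_perturbed_pairings hN hinv (fun k j => lam k j - mu k j) (fun _ => 0)
  have key : ∀ ε : ℝ, ε * (∑ k ∈ Finset.Icc 1 N, ∑ j ∈ Finset.Ico 1 k, (lam k j - mu k j) ^ 2) +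
      ε ^ 2 * (∑ k ∈ Finset.Icc 1 N, ∑ j ∈ Finset.Ico 1 k, (lam k j - mu k j) * r k j) = 0 := by
    intro ε
    have h1 := hlam.identity (N + 1) (orbit N 0) fun l => baseG N H l + ε • d l
    have h2 := hmu.identity (N + 1) (orbit N 0) fun l => baseG N H l + ε • d l
    have h3 := sub_eq_zero.2 (add_left_cancel (h1.symm.trans h2))
    rw [← h3]
    simp only [← Finset.sum_sub_distrib, Finset.mul_sum, ← Finset.sum_add_distrib]
    refine Finset.sum_congr rfl fun k hk => Finset.sum_congr rfl fun j hj => ?_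
    rw [Finset.mem_Icc] at hk
    rw [Finset.mem_Ico] at hj
    rw [(hr ε k hk.1 hk.2).1 j hj.1 hj.2]
    ring
  -- Comparing `ε = 1` with `ε = -1` isolates the linear coefficient.
  have hsum : ∑ k ∈ Finset.Icc 1 N, ∑ j ∈ Finset.Ico 1 k, (lam k j - mu k j) ^ 2 = 0 := by
    linarith [key 1, key (-1)]
  rw [Finset.sum_eq_zero_iff_of_nonneg fun k _ => Finset.sum_nonneg fun j _ => sq_nonneg _] at hsum
  funext k j
  by_cases h : 1 ≤ j ∧ j < k ∧ k ≤ N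
  · have h1 := hsum k (Finset.mem_Icc.2 (by omega))
    rw [Finset.sum_eq_zero_iff_of_nonneg fun j _ => sq_nonneg _] at h1
    exact sub_eq_zero.1 (pow_eq_zero_iff two_ne_zero |>.1 (h1 j (Finset.mem_Ico.2 (by omega))))
  · rw [hlam.support k j h, hmu.support k j h]

theorem existsUnique_isCertificate (hN : 1 ≤ N) (hinv : HInvariance N H) :
    ∃! lam, IsCertificate N H lam := by
  obtain ⟨lam, hlam⟩ := exists_isCertificate hN hinv
  exact ⟨lam, hlam, fun mu hmu => hmu.eq hN hinv hlam⟩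

theorem isCertificate_certificate (hN : 1 ≤ N) (hinv : HInvariance N H) :
    IsCertificate N H (certificate N H) := by
  have h := existsUnique_isCertificate hN hinv
  rw [certificate, dif_pos h]
  exact h.choose_spec.1

end Uniqueness

/-! ### The operator violating the bound. -/

section Construction

variable {N : ℕ} {H : Matrix (Fin (N - 1)) (Fin (N - 1)) ℝ}

/-- Formal iterates with nonnegative pairings are the iterates of a nonexpansive operator. -/
theorem exists_operator_of_pairings_nonneg {E : Type*} [NormedAddCommGroup E]
    [InnerProductSpace ℝ E] [FiniteDimensional ℝ E] (hN : 1 ≤ N) (y0 : E) (g : ℕ → E)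
    (hpair : ∀ k j, 1 ≤ j → j < k → k ≤ N →
      0 ≤ inner ℝ (formalX H y0 g k - formalX H y0 g j) (g k - g j))
    (hfix : ∀ k, 1 ≤ k → k ≤ N → 0 ≤ inner ℝ (formalX H y0 g k) (g k)) :
    ∃ T : E → E, LipschitzWith 1 T ∧ T 0 = 0 ∧
      iterate H T y0 (N - 1) - T (iterate H T y0 (N - 1)) = (2 : ℝ) • g N := by
  let x := formalX H y0 g
  -- This turns nonnegative pairings into contraction of the relation `x_k + g_k ↦ x_k - g_k`; the
  -- pair `(0, 0)` adds the fixed point.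
  have contract : ∀ a b : E, 0 ≤ inner ℝ a b → ‖a - b‖ ≤ ‖a + b‖ := by
    intro a b hab
    refine le_of_sq_le_sq ?_ (norm_nonneg _)
    rw [norm_sub_sq_real, norm_add_sq_real]
    linarith
  have hpair' : ∀ k j, 1 ≤ k → k ≤ N → 1 ≤ j → j ≤ N →
      0 ≤ inner ℝ (x k - x j) (g k - g j) := by
    intro k j hk hk' hj hj'
    rcases lt_trichotomy j k with h | rfl | h
    · exact hpair k j hj h hk'
    · simp
    · rw [← neg_sub (x j), ← neg_sub (g j), inner_neg_neg]
      exact hpair j k hk h hj'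
  obtain ⟨T, hT, hTG⟩ := exists_lipschitzWith_one_of_relation
    ({a | a = (0, 0) ∨ ∃ k, 1 ≤ k ∧ k ≤ N ∧ a = (x k + g k, x k - g k)} : Set (E × E)) (by
      rintro a (rfl | ⟨k, hk, hk', rfl⟩) b (rfl | ⟨j, hj, hj', rfl⟩)
      · simp
      · simpa only [zero_sub, norm_neg] using contract _ _ (hfix j hj hj')
      · simpa only [sub_zero] using contract _ _ (hfix k hk hk')
      · have := contract _ _ (hpair' k j hk hk' hj hj')
        convert this using 2
        · simp only; abel
        · simp only; abel)
  have hTY : ∀ k < N, T (formalY H y0 g k) = formalY H y0 g k - (2 : ℝ) • g (k + 1) := by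
    intro k hk
    have h1 := hTG _ (Or.inr ⟨k + 1, by omega, by omega, rfl⟩)
    have h2 : x (k + 1) = formalY H y0 g k - g (k + 1) := rfl
    simp only [h2, sub_add_cancel] at h1
    rw [h1]
    module
  refine ⟨T, hT, hTG _ (Or.inl rfl), ?_⟩
  rw [iterate_eq_formalY H T y0 g (N - 1) (fun k hk => hTY k (by omega)) (N - 1) le_rfl,
    hTY (N - 1) (by omega), Nat.sub_add_cancel hN]
  abel

theorem eventually_pos_mul_add_sq_mul {a : ℝ} (ha : 0 < a) (b : ℝ) :
    ∀ᶠ ε : ℝ in nhdsWithin 0 (Set.Ioi 0), 0 < ε * a + ε ^ 2 * b := by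
  have h : Filter.Tendsto (fun ε : ℝ => a + ε * b) (nhdsWithin 0 (Set.Ioi 0)) (nhds a) := by
    have : Continuous fun ε : ℝ => a + ε * b := by fun_prop
    simpa using (this.tendsto 0).mono_left nhdsWithin_le_nhds
  filter_upwards [h.eventually (lt_mem_nhds ha), self_mem_nhdsWithin] with ε hε hpos
  have := mul_pos (Set.mem_Ioi.1 hpos) hε
  linarith

/-- The identity rearranges to `N² ‖g_N‖² = 1 - 2N (⟪x_N, g_N⟫ + ∑ lam · pairing) - ‖N g_N - y_0‖²`.
The last term is of second order in `ε`, as `N g_N = y_0` at the base instance, so the negative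
certificate decides the sign. -/
theorem exists_norm_sq_gt_of_certificate_neg (hN : 1 ≤ N) (hinv : HInvariance N H)
    {lam : ℕ → ℕ → ℝ} (hlam : IsCertificate N H lam) {i₀ j₀ : ℕ} (hj₀ : 1 ≤ j₀) (hij : j₀ < i₀)
    (hi₀ : i₀ ≤ N) (hneg : lam i₀ j₀ < 0) :
    ∃ g : ℕ → EuclideanSpace ℝ (Fin (N + 1)),
      (∀ k j, 1 ≤ j → j < k → k ≤ N →
        0 ≤ inner ℝ (formalX H (orbit N 0) g k - formalX H (orbit N 0) g j) (g k - g j)) ∧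
      (∀ k, 1 ≤ k → k ≤ N → 0 ≤ inner ℝ (formalX H (orbit N 0) g k) (g k)) ∧
      1 < (N : ℝ) ^ 2 * ‖g N‖ ^ 2 := by
  set S := ∑ k ∈ Finset.Icc 1 N, ∑ j ∈ Finset.Ico 1 k, lam k j with hS
  -- `η` is the positive rate given to every pairing (contributing `η * S`) and to each `⟪x_k, g_k⟫`
  -- (the `+ 1` is `k = N`). It is small enough to use up at most half of `-lam i₀ j₀`.
  obtain ⟨η, hη, hηS⟩ : ∃ η : ℝ, 0 < η ∧ lam i₀ j₀ + η * (S + 1) < 0 := by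
    refine ⟨-lam i₀ j₀ / (2 * (|S + 1| + 1)), by have := neg_pos.2 hneg; positivity, ?_⟩
    have h1 : -lam i₀ j₀ / (2 * (|S + 1| + 1)) * (S + 1) ≤
        -lam i₀ j₀ / (2 * (|S + 1| + 1)) * (|S + 1| + 1) := by
      have := neg_pos.2 hneg
      gcongr
      linarith [le_abs_self (S + 1)]
    have h2 : -lam i₀ j₀ / (2 * (|S + 1| + 1)) * (|S + 1| + 1) = -lam i₀ j₀ / 2 := by
      field_simp
    linarith
  let t : ℕ → ℕ → ℝ := fun k j => η + if k = i₀ then if j = j₀ then 1 else 0 else 0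
  have ht : ∀ k j, 0 < t k j := by
    intro k j
    simp only [t]
    split_ifs <;> linarith
  have hsumt : ∑ k ∈ Finset.Icc 1 N, ∑ j ∈ Finset.Ico 1 k, lam k j * t k j =
      η * S + lam i₀ j₀ := by
    simp only [t, mul_add, Finset.sum_add_distrib, mul_ite, mul_one, mul_zero]
    congr 1
    · simp only [hS, ← Finset.sum_mul, mul_comm η]
    · rw [Finset.sum_eq_single i₀, Finset.sum_eq_single j₀]
      · simp
      · intro j _ hj
        simp [hj]
      · intro h
        exact absurd (Finset.mem_Ico.2 ⟨hj₀, hij⟩) h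
      · intro k _ hk
        simp [hk]
      · intro h
        exact absurd (Finset.mem_Icc.2 ⟨by omega, hi₀⟩) h
  obtain ⟨d, r, r', hr⟩ := exists_perturbed_pairings hN hinv t fun _ => η
  set R := ∑ k ∈ Finset.Icc 1 N, ∑ j ∈ Finset.Ico 1 k, lam k j * r k j with hR
  set C := ‖(N : ℝ) • d N‖ ^ 2 with hC
  have hN0 : (0 : ℝ) < N := by positivity
  have hnorm : ∀ ε : ℝ, (N : ℝ) ^ 2 * ‖baseG N H N + ε • d N‖ ^ 2 = 1 +
      (ε * (2 * N * -(lam i₀ j₀ + η * (S + 1))) + ε ^ 2 * (2 * N * -(R + r' N) - C)) := by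
    intro ε
    have h1 := hlam.identity (N + 1) (orbit N 0) fun l => baseG N H l + ε • d l
    have h2 : ∑ k ∈ Finset.Icc 1 N, ∑ j ∈ Finset.Ico 1 k, lam k j *
        inner ℝ (formalX H (orbit N 0) (fun l => baseG N H l + ε • d l) k -
            formalX H (orbit N 0) (fun l => baseG N H l + ε • d l) j)
            ((baseG N H k + ε • d k) - (baseG N H j + ε • d j)) =
        ε * (η * S + lam i₀ j₀) + ε ^ 2 * R := by
      rw [← hsumt, hR]
      simp only [Finset.mul_sum, ← Finset.sum_add_distrib]
      refine Finset.sum_congr rfl fun k hk => Finset.sum_congr rfl fun j hj => ?_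
      rw [Finset.mem_Icc] at hk
      rw [Finset.mem_Ico] at hj
      rw [(hr ε k hk.1 hk.2).1 j hj.1 hj.2]
      ring
    rw [h2, inner_sub_right, real_inner_comm, (hr ε N hN le_rfl).2] at h1
    have h3 : (N : ℝ) • (baseG N H N + ε • d N) - orbit N 0 = ε • ((N : ℝ) • d N) := by
      rw [smul_add, natCast_smul_baseG hN hinv]
      module
    have h4 := congrArg (fun v => ‖v‖ ^ 2) h3
    rw [norm_sub_sq_real, norm_orbit_zero hN, norm_smul ε, mul_pow, real_inner_smul_left,
      norm_smul, mul_pow, Real.norm_eq_abs, Real.norm_eq_abs, sq_abs, sq_abs, ← hC] at h4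
    have h5 : inner ℝ (baseG N H N + ε • d N) (orbit N 0) =
        N * ‖baseG N H N + ε • d N‖ ^ 2 + (ε * η + ε ^ 2 * r' N) +
          (ε * (η * S + lam i₀ j₀) + ε ^ 2 * R) := by linarith
    rw [h5] at h4
    linarith
  have hev1 : ∀ᶠ ε : ℝ in nhdsWithin 0 (Set.Ioi 0), ∀ k ∈ Finset.Icc 1 N,
      ∀ j ∈ Finset.Ico 1 k, 0 < ε * t k j + ε ^ 2 * r k j := by
    rw [Filter.eventually_all_finset]
    intro k _
    rw [Filter.eventually_all_finset]
    exact fun j _ => eventually_pos_mul_add_sq_mul (ht k j) _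
  have hev2 : ∀ᶠ ε : ℝ in nhdsWithin 0 (Set.Ioi 0), ∀ k ∈ Finset.Icc 1 N,
      0 < ε * η + ε ^ 2 * r' k := by
    rw [Filter.eventually_all_finset]
    exact fun k _ => eventually_pos_mul_add_sq_mul hη _
  have hev3 := eventually_pos_mul_add_sq_mul
    (mul_pos (mul_pos two_pos hN0) (neg_pos.2 hηS)) (2 * N * -(R + r' N) - C)
  obtain ⟨ε, h1, h2, h3⟩ := (hev1.and (hev2.and hev3)).exists
  refine ⟨fun l => baseG N H l + ε • d l, fun k j hj hjk hk => ?_, fun k hk hk' => ?_, ?_⟩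
  · rw [(hr ε k (by omega) hk).1 j hj hjk]
    exact (h1 k (Finset.mem_Icc.2 (by omega)) j (Finset.mem_Ico.2 (by omega))).le
  · rw [(hr ε k hk hk').2]
    exact (h2 k (Finset.mem_Icc.2 (by omega))).le
  · rw [hnorm ε]
    linarith

end Construction

end HMatrix

theorem mainTheorem4 (N : ℕ) (hN : 1 ≤ N) (H : Matrix (Fin (N - 1)) (Fin (N - 1)) ℝ)
    (hlower : ∀ i j, i < j → H i j = 0) (hinv : HMatrix.HInvariance N H) :
    (∃! lam : ℕ → ℕ → ℝ, HMatrix.IsCertificate N H lam) ∧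
    ∀ i₀ j₀ : ℕ, 1 ≤ j₀ → j₀ < i₀ → i₀ ≤ N → HMatrix.certificate N H i₀ j₀ < 0 →
      ∃ (T : EuclideanSpace ℝ (Fin (N + 1)) → EuclideanSpace ℝ (Fin (N + 1)))
        (y₀ yStar : EuclideanSpace ℝ (Fin (N + 1))),
        LipschitzWith 1 T ∧ T yStar = yStar ∧ ‖y₀ - yStar‖ = 1 ∧
        4 / (N : ℝ) ^ 2 <
          ‖HMatrix.iterate H T y₀ (N - 1) - T (HMatrix.iterate H T y₀ (N - 1))‖ ^ 2 := by
  refine ⟨HMatrix.existsUnique_isCertificate hN hinv, fun i₀ j₀ hj₀ hij hi₀ hneg => ?_⟩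
  obtain ⟨g, hpair, hfix, hnorm⟩ := HMatrix.exists_norm_sq_gt_of_certificate_neg hN hinv
    (HMatrix.isCertificate_certificate hN hinv) hj₀ hij hi₀ hneg
  obtain ⟨T, hT, hT0, hTN⟩ := HMatrix.exists_operator_of_pairings_nonneg hN _ g hpair hfix
  refine ⟨T, HMatrix.orbit N 0, 0, hT, hT0, ?_, ?_⟩
  · rw [sub_zero, HMatrix.norm_orbit_zero hN]
  · have hN0 : (0 : ℝ) < N := by positivity
    rw [hTN, norm_smul, mul_pow, Real.norm_eq_abs, sq_abs, div_lt_iff₀ (by positivity)]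
    linarith
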